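/- Let $a\in(-1,\infty)$ and let $f:\mathbb{C}\to\mathbb{C}$, $f(z)=\exp(z)+a$. Write $f^n$ for the $n$-th iterate of $f$. Then the escaping set $$I(f)=\{z\in\mathbb{C}: f^n(z)\to\infty \text{ as } n\to\infty\}$$ is a connected subset of $\mathbb{C}$. -/

import Mathlib

/-- The exponential map `z ↦ exp z + a` with real parameter `a`. -/
noncomputable def expMap (a : ℝ) (z : ℂ) : ℂ := Complex.exp z + (a : ℂ)

/-- The escaping set of a self-map of the plane: the points whose orbit tends to infinity,
that is, eventually leaves every compact set. -/
def escapingSet (f : ℂ → ℂ) : Set ℂ :=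
  {z : ℂ | Filter.Tendsto (fun n : ℕ => f^[n] z) Filter.atTop (Filter.cocompact ℂ)}

open Complex Filter Set Topology ComplexConjugate

/-! Let `X = eventuallyReal a`. Then `X ⊆ I(f) ⊆ closure X`, so it suffices that `X` is connected.
Real orbits tend to `+∞` because `a > -1`, which gives the first inclusion. For the second,
derivatives of iterates blow up at escaping points, but on a disc missing `X` the imaginary parts of
all iterates oscillate by less than `π`, and Cauchy's estimate bounds those derivatives
(`norm_deriv_iterate_le`). Connectedness of `X` rests on `isPreconnected_curves`. Iterated pullbacks
of the line `im = π` accumulate at every real point; at `a - 1` the inverse branch, taken from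
above, carries this accumulation to `π * I`, hence to a point of every curve. Conjugates and
translates of the curves are then glued together, and any other point of `X` is linked to them by
pulling back connected sets (`exists_isPreconnected_subset`). -/

/-- If every member of a sequence of preconnected sets contains a point near which all late members
pass, then the union of the sequence is preconnected. -/
theorem isPreconnected_iUnion_of_recurrent {α : Type*} [TopologicalSpace α] (s : ℕ → Set α)
    (hs : ∀ n, IsPreconnected (s n))
    (h : ∀ k, ∃ p ∈ s k, ∀ N ∈ 𝓝 p, ∀ᶠ j in atTop, (N ∩ s j).Nonempty) :
    IsPreconnected (⋃ n, s n) := by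
  rintro u v hu hv huv ⟨x, hx, hxu⟩ ⟨y, hy, hyv⟩
  obtain ⟨i, hxi⟩ := mem_iUnion.1 hx
  obtain ⟨k, hyk⟩ := mem_iUnion.1 hy
  have key : ∀ j, (s j ∩ u).Nonempty → (s j ∩ v).Nonempty →
      ((⋃ n, s n) ∩ (u ∩ v)).Nonempty := fun j h1 h2 =>
    (hs j u v hu hv ((subset_iUnion s j).trans huv) h1 h2).mono
      (inter_subset_inter_left _ (subset_iUnion s j))
  obtain ⟨p, hp, hpN⟩ := h i
  obtain ⟨q, hq, hqN⟩ := h k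
  -- If `p ∈ u` and `q ∈ v`, one late set meets both; otherwise `s i` or `s k` already does.
  rcases huv (mem_iUnion.2 ⟨i, hp⟩) with hpu | hpv
  · rcases huv (mem_iUnion.2 ⟨k, hq⟩) with hqu | hqv
    · exact key k ⟨q, hq, hqu⟩ ⟨y, hyk, hyv⟩
    · obtain ⟨j, ⟨z, hzu, hz⟩, ⟨w, hwv, hw⟩⟩ :=
        ((hpN u (hu.mem_nhds hpu)).and (hqN v (hv.mem_nhds hqv))).exists
      exact key j ⟨z, hz, hzu⟩ ⟨w, hw, hwv⟩
  · exact key i ⟨x, hxi, hxu⟩ ⟨p, hp, hpv⟩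

/-! ### The inverse branch and the pullbacks of the line `im = π` -/

namespace ExpMap

variable (a : ℝ)

/-- The points that are eventually mapped to the real axis. -/
def eventuallyReal : Set ℂ := {z | ∃ n : ℕ, ((expMap a)^[n] z).im = 0}

/-- The inverse branch of `expMap a` on the upper half-plane with values in `0 < im < π`. -/
noncomputable def invBranch (w : ℂ) : ℂ := log (w - a)

/-- The open upper half-plane. -/
def upper : Set ℂ := {z | 0 < z.im}

/-- The horizontal line through `c * I`. -/
def line (c : ℝ) : Set ℂ := {z | z.im = c}

/-- The iterated preimages, in the strip `0 < im ≤ π`, of the line `im = π`. -/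
noncomputable def curve (n : ℕ) : Set ℂ := (invBranch a)^[n] '' line Real.pi

/-- The union of all the curves. -/
noncomputable def curves : Set ℂ := ⋃ n, curve a n

/-- Every neighbourhood of `y`, relative to the upper half-plane, meets all late curves. -/
def Recurrent (y : ℂ) : Prop :=
  ∀ N ∈ 𝓝[upper] y, ∀ᶠ j in atTop, (N ∩ curve a j).Nonempty

variable {a}

theorem expMap_invBranch {w : ℂ} (hw : w ≠ a) : expMap a (invBranch a w) = w := by
  rw [expMap, invBranch, exp_log (sub_ne_zero.2 hw)]; ring

theorem ne_of_mem_upper {w : ℂ} (hw : w ∈ upper) : w ≠ a := by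
  rintro rfl
  simp [upper] at hw

theorem invBranch_mem {w : ℂ} (hw : w ∈ upper) :
    0 < (invBranch a w).im ∧ (invBranch a w).im < Real.pi := by
  have h : 0 < (w - a).im := by simpa [upper] using hw
  simp only [invBranch, log_im]
  have h0 : 0 ≤ arg (w - a) := arg_nonneg_iff.2 h.le
  refine ⟨lt_of_le_of_ne h0 fun h' => ?_, lt_of_le_of_ne (arg_le_pi _) fun h' => ?_⟩
  · exact h.ne' (arg_eq_zero_iff.1 h'.symm).2
  · exact h.ne' (arg_eq_pi_iff.1 h').2

theorem invBranch_conj {w : ℂ} (hw : w.im ≠ 0) :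
    invBranch a (conj w) = conj (invBranch a w) := by
  have hne : arg (w - a) ≠ Real.pi := fun h => hw (by simpa using (arg_eq_pi_iff.1 h).2)
  rw [invBranch, invBranch, ← log_conj _ hne, map_sub, conj_ofReal]

theorem continuousAt_invBranch {w : ℂ} (hw : w - a ∈ slitPlane) :
    ContinuousAt (invBranch a) w :=
  (continuousAt_id.sub continuousAt_const).clog hw

theorem continuousOn_invBranch : ContinuousOn (invBranch a) upper := fun w hw =>
  (continuousAt_invBranch (Or.inr (by simpa [upper] using ne_of_gt hw))).continuousWithinAt

theorem mapsTo_iterate_invBranch (n : ℕ) : MapsTo (invBranch a)^[n] upper upper :=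
  MapsTo.iterate (fun _ hw => (invBranch_mem hw).1) n

theorem continuousOn_iterate_invBranch (n : ℕ) : ContinuousOn (invBranch a)^[n] upper := by
  induction n with
  | zero => exact continuousOn_id
  | succ n ih =>
    rw [Function.iterate_succ']
    exact continuousOn_invBranch.comp ih (mapsTo_iterate_invBranch n)

theorem line_pi_subset_upper : line Real.pi ⊆ upper := fun z hz => by
  have : z.im = Real.pi := hz
  simpa [upper, this] using Real.pi_pos

theorem isPreconnected_line (c : ℝ) : IsPreconnected (line c) := by
  have : line c = (fun t : ℝ => (t + c * I : ℂ)) '' univ := by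
    ext z
    simp only [line, mem_ofPred_eq, image_univ, mem_range]
    constructor
    · intro h
      exact ⟨z.re, by apply Complex.ext <;> simp [h]⟩
    · rintro ⟨t, rfl⟩; simp
  rw [this]
  exact isPreconnected_univ.image _ (by fun_prop)

theorem curve_subset_upper (n : ℕ) : curve a n ⊆ upper := by
  rintro _ ⟨w, hw, rfl⟩
  exact mapsTo_iterate_invBranch n (line_pi_subset_upper hw)

theorem isPreconnected_curve (n : ℕ) : IsPreconnected (curve a n) :=
  (isPreconnected_line _).image _ ((continuousOn_iterate_invBranch n).mono line_pi_subset_upper)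

theorem invBranch_mem_curve {n : ℕ} {w : ℂ} (hw : w ∈ curve a n) :
    invBranch a w ∈ curve a (n + 1) := by
  obtain ⟨v, hv, rfl⟩ := hw
  exact ⟨v, hv, Function.iterate_succ_apply' _ _ _⟩

/-- The branch preserves `upper` and raises the index of a curve by one. Only a limit from above is
needed, so `y` may lie on the branch cut. -/
theorem Recurrent.of_tendsto {y y' : ℂ} (hy : Recurrent a y)
    (h : Tendsto (invBranch a) (𝓝[upper] y) (𝓝 y')) : Recurrent a y' := by
  intro N hN
  have h' : Tendsto (invBranch a) (𝓝[upper] y) (𝓝[upper] y') :=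
    tendsto_nhdsWithin_iff.2 ⟨h, eventually_nhdsWithin_of_forall fun w hw => (invBranch_mem hw).1⟩
  obtain ⟨J, hJ⟩ := eventually_atTop.1 (hy _ (h' hN))
  refine eventually_atTop.2 ⟨J + 1, fun j hj => ?_⟩
  obtain ⟨i, rfl⟩ : ∃ i, j = i + 1 := ⟨j - 1, by omega⟩
  obtain ⟨w, hwN, hw⟩ := hJ i (by omega)
  exact ⟨_, hwN, invBranch_mem_curve hw⟩

theorem Recurrent.invBranch {y : ℂ} (hy : Recurrent a y) (h : y - a ∈ slitPlane) :
    Recurrent a (invBranch a y) :=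
  hy.of_tendsto (continuousAt_invBranch h).continuousWithinAt

/-! ### Real dynamics and accumulation of the curves -/

/-- The restriction of `expMap a` to the real axis. -/
noncomputable def realMap (a x : ℝ) : ℝ := Real.exp x + a

theorem expMap_ofReal (x : ℝ) : expMap a x = realMap a x := by simp [expMap, realMap]

theorem eq_ofReal_re_of_im_eq_zero {z : ℂ} (hz : z.im = 0) : z = z.re := by
  apply Complex.ext <;> simp [hz]

theorem iterate_expMap_ofReal (n : ℕ) (x : ℝ) :
    (expMap a)^[n] x = ((realMap a)^[n] x : ℝ) := by
  induction n with
  | zero => rfl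
  | succ n ih => rw [Function.iterate_succ_apply', Function.iterate_succ_apply', ih, expMap_ofReal]

/-- The condition `-1 < a` enters only through this bound: each step then moves right by a fixed
positive amount. -/
theorem add_le_realMap (x : ℝ) : x + (1 + a) ≤ realMap a x := by
  have := Real.add_one_le_exp x
  unfold realMap; linarith

theorem add_le_iterate_realMap (n : ℕ) (x : ℝ) : x + n * (1 + a) ≤ (realMap a)^[n] x := by
  induction n with
  | zero => simp
  | succ n ih =>
    rw [Function.iterate_succ_apply']
    have := add_le_realMap (a := a) ((realMap a)^[n] x)
    push_cast; linarith

theorem tendsto_iterate_realMap (ha : -1 < a) (x : ℝ) :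
    Tendsto (fun n => (realMap a)^[n] x) atTop atTop := by
  refine tendsto_atTop_mono (fun n => add_le_iterate_realMap n x) ?_
  exact tendsto_atTop_add_const_left _ _
    (tendsto_natCast_atTop_atTop.atTop_mul_const (by linarith))

theorem invBranch_realMap (x : ℝ) : invBranch a (realMap a x : ℝ) = x := by
  rw [invBranch, realMap, ofReal_add, add_sub_cancel_right, ← ofReal_log (Real.exp_pos x).le,
    Real.log_exp]

theorem realMap_sub_mem_slitPlane (x : ℝ) : ((realMap a x : ℝ) : ℂ) - a ∈ slitPlane := by
  left
  simp [realMap, exp_ofReal_re, Real.exp_pos]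

theorem norm_invBranch_sub_le {x : ℝ} (hx : 2 ≤ x) {w : ℂ}
    (hw : ‖w - (realMap a x : ℝ)‖ ≤ Real.pi) :
    ‖invBranch a w - x‖ ≤ 1 / 2 * ‖w - (realMap a x : ℝ)‖ := by
  -- With `π < 4` this leaves `re (v - a) ≥ 2` on the ball, so the derivative `1 / (v - a)` is at
  -- most `1 / 2` in norm.
  have hexp : 6 ≤ Real.exp x := by
    have h1 : Real.exp 2 ≤ Real.exp x := Real.exp_le_exp.2 hx
    have h2 : Real.exp 2 = Real.exp 1 * Real.exp 1 := by rw [← Real.exp_add]; norm_num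
    have := Real.exp_one_gt_d9
    nlinarith
  have hre : ∀ v ∈ Metric.closedBall ((realMap a x : ℝ) : ℂ) Real.pi, 2 ≤ (v - a).re := by
    intro v hv
    have h1 := (abs_le.1 ((abs_re_le_norm _).trans (mem_closedBall_iff_norm.1 hv))).1
    have := Real.pi_lt_four
    simp only [sub_re, ofReal_re, realMap] at h1 ⊢
    linarith
  have := Convex.norm_image_sub_le_of_norm_hasDerivWithin_le
    (f := invBranch a) (f' := fun v => 1 / (v - a)) (C := 1 / 2) (fun v hv =>
      (((hasDerivAt_id v).sub_const (a : ℂ)).clog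
        (Or.inl (by have := hre v hv; simp only [id]; linarith))).hasDerivWithinAt)
    (fun v hv => by
      rw [norm_div, norm_one]
      exact one_div_le_one_div_of_le two_pos ((hre v hv).trans (re_le_norm _)))
    (convex_closedBall _ _) (Metric.mem_closedBall_self Real.pi_pos.le)
    (mem_closedBall_iff_norm.2 hw)
  rwa [invBranch_realMap] at this

theorem norm_iterate_invBranch_sub_le (ha : -1 < a) (n : ℕ) : ∀ {x : ℝ}, 2 ≤ x → ∀ {w : ℂ},
    ‖w - ((realMap a)^[n] x : ℝ)‖ ≤ Real.pi →
    ‖(invBranch a)^[n] w - x‖ ≤ (1 / 2) ^ n * ‖w - ((realMap a)^[n] x : ℝ)‖ := by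
  induction n with
  | zero => intro x _ w _; simp
  | succ n ih =>
    intro x hx w hw
    rw [Function.iterate_succ_apply' (realMap a)] at hw ⊢
    rw [Function.iterate_succ_apply]
    have h2 : 2 ≤ (realMap a)^[n] x := by
      have := add_le_iterate_realMap (a := a) n x
      have : 0 ≤ (n : ℝ) * (1 + a) := mul_nonneg n.cast_nonneg (by linarith)
      linarith
    have h1 := norm_invBranch_sub_le h2 hw
    have h3 := ih hx (w := invBranch a w)
      (h1.trans (by linarith [norm_nonneg (w - (realMap a ((realMap a)^[n] x) : ℝ))]))
    refine h3.trans ?_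
    rw [pow_succ, mul_assoc]
    gcongr

theorem recurrent_of_two_le (ha : -1 < a) {x : ℝ} (hx : 2 ≤ x) : Recurrent a x := by
  intro N hN
  -- Start at height `π` above the `n`-th real iterate and pull back `n` times: the distance `π` to
  -- the real orbit shrinks by `2 ^ n`.
  set q : ℕ → ℂ := fun n => (invBranch a)^[n] (((realMap a)^[n] x : ℝ) + Real.pi * I) with hq
  have hmem : ∀ n, q n ∈ curve a n := fun n => ⟨_, by simp [line], rfl⟩
  have hlim : Tendsto q atTop (𝓝 (x : ℂ)) := by
    rw [tendsto_iff_norm_sub_tendsto_zero]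
    have hb : ∀ n, ‖q n - x‖ ≤ (1 / 2) ^ n * Real.pi := fun n => by
      have e : ‖(((realMap a)^[n] x : ℝ) + Real.pi * I : ℂ) - ((realMap a)^[n] x : ℝ)‖
          = Real.pi := by
        rw [add_sub_cancel_left]; simp [abs_of_pos Real.pi_pos]
      have := norm_iterate_invBranch_sub_le ha n hx e.le
      rwa [e] at this
    refine squeeze_zero (fun _ => norm_nonneg _) hb ?_
    simpa using (tendsto_pow_atTop_nhds_zero_of_lt_one (r := (1 / 2 : ℝ)) (by norm_num)
      (by norm_num)).mul_const Real.pi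
  have := tendsto_nhdsWithin_iff.2
    ⟨hlim, Eventually.of_forall fun n => curve_subset_upper n (hmem n)⟩
  exact (this.eventually_mem hN).mono fun n hn => ⟨q n, hn, hmem n⟩

theorem recurrent_ofReal (ha : -1 < a) (x : ℝ) : Recurrent a x := by
  obtain ⟨n, hn⟩ := ((tendsto_iterate_realMap ha x).eventually_ge_atTop 2).exists
  induction n generalizing x with
  | zero => exact recurrent_of_two_le ha hn
  | succ n ih =>
    rw [Function.iterate_succ_apply] at hn
    have := (ih _ hn).invBranch (realMap_sub_mem_slitPlane x)
    rwa [invBranch_realMap] at this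

/-- The real point `a - 1` lies on the branch cut, and `log (w - a)` tends to `log (-1) = π * I` as
`w` approaches it from above. -/
theorem recurrent_pi_mul_I (ha : -1 < a) : Recurrent a (Real.pi * I) := by
  refine (recurrent_ofReal ha (a - 1)).of_tendsto ?_
  have h := continuousWithinAt_log_of_re_neg_of_im_zero (z := -1) (by simp) (by simp)
  have h2 : Tendsto (fun w : ℂ => w - a) (𝓝[upper] ((a - 1 : ℝ) : ℂ))
      (𝓝[{z : ℂ | 0 ≤ z.im}] (-1)) := by
    refine tendsto_nhdsWithin_iff.2 ⟨?_, eventually_nhdsWithin_of_forall fun w hw => ?_⟩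
    · have : ContinuousAt (fun w : ℂ => w - a) ((a - 1 : ℝ) : ℂ) := by fun_prop
      have := this.tendsto
      simp only [ofReal_sub, ofReal_one, sub_sub_cancel_left] at this
      simpa using this.mono_left nhdsWithin_le_nhds
    · simpa [upper] using le_of_lt hw
  have := h.tendsto.comp h2
  rwa [log_neg_one] at this

theorem recurrent_iterate (ha : -1 < a) (n : ℕ) :
    Recurrent a ((invBranch a)^[n] (Real.pi * I)) := by
  induction n with
  | zero => exact recurrent_pi_mul_I ha
  | succ n ih =>
    rw [Function.iterate_succ_apply']
    refine ih.invBranch (Or.inr ?_)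
    have : 0 < ((invBranch a)^[n] (Real.pi * I)).im :=
      mapsTo_iterate_invBranch n (line_pi_subset_upper (by simp [line]))
    simpa using this.ne'

theorem isPreconnected_curves (ha : -1 < a) : IsPreconnected (curves a) :=
  isPreconnected_iUnion_of_recurrent _ isPreconnected_curve fun k =>
    ⟨_, ⟨Real.pi * I, by simp [line], rfl⟩, fun N hN =>
      recurrent_iterate ha k N (mem_nhdsWithin_of_mem_nhds hN)⟩

theorem line_zero_subset_closure (ha : -1 < a) : line 0 ⊆ closure (curves a) := by
  intro z hz
  obtain ⟨x, rfl⟩ : ∃ x : ℝ, z = x := ⟨_, eq_ofReal_re_of_im_eq_zero hz⟩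
  refine mem_closure_iff_nhds.2 fun N hN => ?_
  obtain ⟨j, w, hw, hwj⟩ := (recurrent_ofReal ha x N (mem_nhdsWithin_of_mem_nhds hN)).exists
  exact ⟨w, hw, mem_iUnion.2 ⟨j, hwj⟩⟩

theorem curves_subset_upper : curves a ⊆ upper := iUnion_subset curve_subset_upper

theorem line_pi_subset_curves : line Real.pi ⊆ curves a := fun z hz =>
  mem_iUnion.2 ⟨0, z, hz, rfl⟩

theorem invBranch_mem_curves {w : ℂ} (hw : w ∈ curves a) : invBranch a w ∈ curves a := by
  obtain ⟨n, hn⟩ := mem_iUnion.1 hw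
  exact mem_iUnion.2 ⟨n + 1, invBranch_mem_curve hn⟩

theorem mem_eventuallyReal_of_expMap {z : ℂ} (h : expMap a z ∈ eventuallyReal a) :
    z ∈ eventuallyReal a := by
  obtain ⟨n, hn⟩ := h
  exact ⟨n + 1, by rwa [Function.iterate_succ_apply]⟩

theorem line_subset_eventuallyReal (k : ℤ) : line (k * Real.pi) ⊆ eventuallyReal a := by
  intro z hz
  refine ⟨1, ?_⟩
  have h : z.im = k * Real.pi := hz
  simp [expMap, exp_im, h]

theorem curves_subset_eventuallyReal : curves a ⊆ eventuallyReal a := by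
  refine iUnion_subset fun n => ?_
  induction n with
  | zero =>
    rintro _ ⟨w, hw, rfl⟩
    exact line_subset_eventuallyReal 1 (by simpa using hw)
  | succ n ih =>
    rintro _ ⟨w, hw, rfl⟩
    have hu : (invBranch a)^[n] w ∈ upper := mapsTo_iterate_invBranch n (line_pi_subset_upper hw)
    apply mem_eventuallyReal_of_expMap
    rw [Function.iterate_succ_apply', expMap_invBranch (ne_of_mem_upper hu)]
    exact ih ⟨w, hw, rfl⟩

/-! ### Gluing by translation and conjugation -/

/-- Translation by `2 * π * k * I`, a deck transformation of `expMap a`. -/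
noncomputable def shift (k : ℤ) (z : ℂ) : ℂ := z + k * (2 * Real.pi * I)

theorem continuous_shift (k : ℤ) : Continuous (shift k) := by unfold shift; fun_prop

theorem shift_im (k : ℤ) (z : ℂ) : (shift k z).im = z.im + k * (2 * Real.pi) := by simp [shift]

theorem expMap_shift (k : ℤ) (z : ℂ) : expMap a (shift k z) = expMap a z := by
  simp [expMap, shift, exp_add, exp_int_mul_two_pi_mul_I]

theorem iterate_expMap_conj (n : ℕ) (z : ℂ) :
    (expMap a)^[n] (conj z) = conj ((expMap a)^[n] z) := by
  induction n with
  | zero => rfl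
  | succ n ih =>
    rw [Function.iterate_succ_apply', Function.iterate_succ_apply', ih]
    simp [expMap, exp_conj]

theorem conj_mem_eventuallyReal {z : ℂ} (h : z ∈ eventuallyReal a) :
    conj z ∈ eventuallyReal a := by
  obtain ⟨n, hn⟩ := h
  exact ⟨n, by simp [iterate_expMap_conj, hn]⟩

theorem expMap_mem_eventuallyReal {z : ℂ} (h : z ∈ eventuallyReal a) :
    expMap a z ∈ eventuallyReal a := by
  obtain ⟨n, hn⟩ := h
  refine ⟨n, ?_⟩
  obtain ⟨x, hx⟩ : ∃ x : ℝ, (expMap a)^[n] z = x := ⟨_, eq_ofReal_re_of_im_eq_zero hn⟩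
  rw [← Function.iterate_succ_apply, Function.iterate_succ_apply', hx, expMap_ofReal, ofReal_im]

theorem shift_mem_eventuallyReal {z : ℂ} (k : ℤ) (h : z ∈ eventuallyReal a) :
    shift k z ∈ eventuallyReal a :=
  mem_eventuallyReal_of_expMap (by rw [expMap_shift]; exact expMap_mem_eventuallyReal h)

variable (a) in
/-- The curves, their mirror images, and the real axis between them. -/
noncomputable def doubleCurves : Set ℂ := (curves a ∪ line 0) ∪ conj '' (curves a ∪ line 0)

theorem isPreconnected_curves_union (ha : -1 < a) : IsPreconnected (curves a ∪ line 0) :=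
  (isPreconnected_curves ha).subset_closure subset_union_left
    (union_subset subset_closure (line_zero_subset_closure ha))

theorem isPreconnected_doubleCurves (ha : -1 < a) : IsPreconnected (doubleCurves a) :=
  (isPreconnected_curves_union ha).union 0 (Or.inr (by simp [line]))
    ⟨0, Or.inr (by simp [line]), by simp⟩
    ((isPreconnected_curves_union ha).image _ continuous_conj.continuousOn)

theorem curves_union_subset : curves a ∪ line 0 ⊆ eventuallyReal a :=
  union_subset curves_subset_eventuallyReal
    (by simpa using line_subset_eventuallyReal (a := a) 0)

theorem doubleCurves_subset : doubleCurves a ⊆ eventuallyReal a := by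
  refine union_subset curves_union_subset ?_
  rintro _ ⟨z, hz, rfl⟩
  exact conj_mem_eventuallyReal (curves_union_subset hz)

theorem curves_im_le {z : ℂ} (hz : z ∈ curves a) : z.im ≤ Real.pi := by
  obtain ⟨n, w, hw, rfl⟩ := mem_iUnion.1 hz
  cases n with
  | zero => exact le_of_eq hw
  | succ n =>
    rw [Function.iterate_succ_apply']
    exact (invBranch_mem (mapsTo_iterate_invBranch n (line_pi_subset_upper hw))).2.le

theorem neg_pi_le_im_of_mem_doubleCurves {z : ℂ} (hz : z ∈ doubleCurves a) :
    -Real.pi ≤ z.im := by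
  have := Real.pi_pos
  rcases hz with (h | h) | ⟨w, h | h, rfl⟩
  · have : 0 < z.im := curves_subset_upper h
    linarith
  · have : z.im = 0 := h
    linarith
  · have := curves_im_le h
    simpa using this
  · have : w.im = 0 := h
    simp [this]; linarith

variable (a) in
/-- The part in the upper half-plane of the translates of the curves, glued along the lines. -/
noncomputable def chain : ℕ → Set ℂ
  | 0 => curves a
  | n + 1 => shift (n + 1 : ℕ) '' doubleCurves a

variable (a) in
/-- The union of the chain. -/
noncomputable def ladder : Set ℂ := ⋃ n, chain a n

theorem isPreconnected_ladder (ha : -1 < a) : IsPreconnected (ladder a) := by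
  refine IsPreconnected.iUnion_of_chain (fun n => ?_) fun n => ?_
  · cases n with
    | zero => exact isPreconnected_curves ha
    | succ n => exact (isPreconnected_doubleCurves ha).image _ (continuous_shift _).continuousOn
  · have hpi : (Real.pi * I : ℂ) ∈ curves a := line_pi_subset_curves (by simp [line])
    -- Consecutive pieces share the point `(2 * n + 1) * π * I`.
    refine ⟨shift n (Real.pi * I), ?_, ?_⟩
    · cases n with
      | zero => simpa [chain, shift] using hpi
      | succ n => exact ⟨_, Or.inl (Or.inl hpi), rfl⟩
    · refine ⟨conj (Real.pi * I), Or.inr ⟨_, Or.inl hpi, rfl⟩, ?_⟩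
      simp [shift]; ring

theorem ladder_subset : ladder a ⊆ eventuallyReal a ∩ upper := by
  refine iUnion_subset fun n => ?_
  cases n with
  | zero => exact subset_inter curves_subset_eventuallyReal curves_subset_upper
  | succ n =>
    rintro _ ⟨z, hz, rfl⟩
    refine ⟨shift_mem_eventuallyReal _ (doubleCurves_subset hz), ?_⟩
    have h := neg_pi_le_im_of_mem_doubleCurves hz
    have := Real.pi_pos
    have hn : (0 : ℝ) ≤ n := n.cast_nonneg
    simp only [upper, mem_ofPred_eq, shift_im]
    push_cast
    nlinarith

theorem shift_curves_subset_ladder {k : ℤ} (hk : 0 ≤ k) {z : ℂ} (hz : z ∈ curves a) :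
    shift k z ∈ ladder a := by
  lift k to ℕ using hk
  refine mem_iUnion.2 ⟨k, ?_⟩
  cases k with
  | zero => simpa [chain, shift] using hz
  | succ n => exact ⟨z, Or.inl (Or.inl hz), rfl⟩

theorem shift_doubleCurves_subset_ladder {k : ℤ} (hk : 0 < k) {z : ℂ} (hz : z ∈ doubleCurves a) :
    shift k z ∈ ladder a := by
  obtain ⟨n, rfl⟩ : ∃ n : ℕ, k = (n + 1 : ℕ) := ⟨(k - 1).toNat, by omega⟩
  exact mem_iUnion.2 ⟨n + 1, z, hz, rfl⟩

theorem line_subset_ladder {k : ℤ} {z : ℂ} (hz : z ∈ upper) (h : z.im = k * Real.pi) :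
    z ∈ ladder a := by
  have hk : 0 < k := by
    have : 0 < k * Real.pi := h ▸ hz
    exact_mod_cast pos_of_mul_pos_left this Real.pi_pos.le
  have hs : ∀ m : ℤ, z = shift m (shift (-m) z) := fun m => by simp [shift]
  -- Even multiples of `π` give translates of the real axis, odd ones translates of the line `im =
  -- π`.
  rcases Int.even_or_odd' k with ⟨m, rfl | rfl⟩
  · rw [hs m]
    refine shift_doubleCurves_subset_ladder (by omega) (Or.inl (Or.inr ?_))
    simp only [line, mem_ofPred_eq, shift_im, h]
    push_cast; ring
  · rw [hs m]
    refine shift_curves_subset_ladder (by omega) (line_pi_subset_curves ?_)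
    simp only [line, mem_ofPred_eq, shift_im, h]
    push_cast; ring

/-! ### Linking all eventually real points by pullback -/

theorem exists_eq_shift_invBranch (z : ℂ) :
    ∃ k : ℤ, z = shift k (invBranch a (expMap a z)) := by
  have : exp z = exp (invBranch a (expMap a z)) := by
    simp [invBranch, expMap, exp_log (exp_ne_zero z)]
  exact exp_eq_exp_iff_exists_int.1 this

/-- Points of the upper half-plane whose orbit meets the real axis are linked to `π * I` within the
set of such points. -/
theorem exists_isPreconnected_subset (ha : -1 < a) (n : ℕ) : ∀ z ∈ upper,
    ((expMap a)^[n] z).im = 0 → ∃ K ⊆ eventuallyReal a ∩ upper,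
      (Real.pi * I : ℂ) ∈ K ∧ z ∈ K ∧ IsPreconnected K := by
  have hpi : (Real.pi * I : ℂ) ∈ curves a := line_pi_subset_curves (by simp [line])
  have hpl : (Real.pi * I : ℂ) ∈ ladder a := mem_iUnion.2 ⟨0, hpi⟩
  induction n with
  | zero => intro z hz h; exact absurd h (ne_of_gt hz)
  | succ n ih =>
    intro z hz h
    rw [Function.iterate_succ_apply] at h
    obtain ⟨k, hk⟩ := exists_eq_shift_invBranch (a := a) z
    have hpos := Real.pi_pos
    have hz' : 0 < z.im := hz
    rcases lt_trichotomy (expMap a z).im 0 with hw | hw | hw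
    · -- the mirror image of the inverse branch serves the lower half-plane
      have hu : conj (expMap a z) ∈ upper := by simpa [upper] using hw
      obtain ⟨K, hK, hKpi, hKw, hKc⟩ := ih _ hu (by simp [iterate_expMap_conj, h])
      have hkz : z = shift k (conj (invBranch a (conj (expMap a z)))) := by
        rwa [invBranch_conj hw.ne, conj_conj]
      have hk1 : 0 < k := by
        have h1 := (invBranch_mem (a := a) hu).1
        rw [hkz, shift_im, conj_im] at hz'
        by_contra! hneg
        have : (k : ℝ) ≤ 0 := by exact_mod_cast hneg
        nlinarith
      set F : ℂ → ℂ := fun w => shift k (conj (invBranch a w)) with hF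
      have hFc : ContinuousOn F upper := (continuous_shift k).comp_continuousOn
        (continuous_conj.comp_continuousOn continuousOn_invBranch)
      refine ⟨F '' K ∪ ladder a, union_subset ?_ ladder_subset, Or.inr hpl,
        Or.inl ⟨_, hKw, hkz.symm⟩, ?_⟩
      · rintro _ ⟨w, hwK, rfl⟩
        have hwu := (hK hwK).2
        refine ⟨shift_mem_eventuallyReal _ (conj_mem_eventuallyReal
          (mem_eventuallyReal_of_expMap ?_)), ?_⟩
        · rw [expMap_invBranch (ne_of_mem_upper hwu)]; exact (hK hwK).1
        · have h1 := (invBranch_mem (a := a) hwu).2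
          have : (1 : ℝ) ≤ k := by exact_mod_cast hk1
          simp only [hF, upper, mem_ofPred_eq, shift_im, conj_im]
          nlinarith
      -- `K` stays in `upper`, where `F` is continuous; the image meets the ladder at `F (π * I)`.
      · refine (hKc.image F (hFc.mono fun w hw => (hK hw).2)).union (F (Real.pi * I))
          ⟨_, hKpi, rfl⟩ ?_ (isPreconnected_ladder ha)
        exact shift_doubleCurves_subset_ladder hk1
          (Or.inr ⟨_, Or.inl (invBranch_mem_curves hpi), rfl⟩)
    · have hs : Real.sin z.im = 0 := by simpa [expMap, exp_im, Real.exp_ne_zero] using hw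
      obtain ⟨m, hm⟩ := Real.sin_eq_zero_iff.1 hs
      exact ⟨ladder a, ladder_subset, hpl, line_subset_ladder hz hm.symm, isPreconnected_ladder ha⟩
    · obtain ⟨K, hK, hKpi, hKw, hKc⟩ := ih _ hw h
      -- The branch value has imaginary part below `π`, so `k ≤ -1` would put `z` below the real
      -- axis.
      have hk0 : 0 ≤ k := by
        have h1 := (invBranch_mem (a := a) (w := expMap a z) hw).2
        have h2 := shift_im k (invBranch a (expMap a z))
        rw [← hk] at h2
        by_contra! hneg
        have : (k : ℝ) ≤ -1 := by exact_mod_cast (show k ≤ -1 by omega)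
        nlinarith
      set F : ℂ → ℂ := fun w => shift k (invBranch a w) with hF
      have hFc : ContinuousOn F upper :=
        (continuous_shift k).comp_continuousOn continuousOn_invBranch
      refine ⟨F '' K ∪ ladder a, union_subset ?_ ladder_subset, Or.inr hpl,
        Or.inl ⟨_, hKw, hk.symm⟩, ?_⟩
      · rintro _ ⟨w, hwK, rfl⟩
        have hwu := (hK hwK).2
        refine ⟨shift_mem_eventuallyReal _ (mem_eventuallyReal_of_expMap ?_), ?_⟩
        · rw [expMap_invBranch (ne_of_mem_upper hwu)]; exact (hK hwK).1
        · have h1 := (invBranch_mem (a := a) hwu).1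
          have : (0 : ℝ) ≤ k := by exact_mod_cast hk0
          simp only [hF, upper, mem_ofPred_eq, shift_im]
          nlinarith
      · refine (hKc.image F (hFc.mono fun w hw => (hK hw).2)).union (F (Real.pi * I))
          ⟨_, hKpi, rfl⟩ ?_ (isPreconnected_ladder ha)
        exact shift_curves_subset_ladder hk0 (invBranch_mem_curves hpi)

theorem isPreconnected_eventuallyReal (ha : -1 < a) : IsPreconnected (eventuallyReal a) := by
  have hup : ∀ z ∈ eventuallyReal a, z ∈ upper →
      ∃ t ⊆ eventuallyReal a, (0 : ℂ) ∈ t ∧ z ∈ t ∧ IsPreconnected t := by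
    rintro z ⟨n, hn⟩ hz
    obtain ⟨K, hK, hKpi, hKz, hKc⟩ := exists_isPreconnected_subset ha n z hz hn
    refine ⟨(curves a ∪ line 0) ∪ K, union_subset curves_union_subset fun w hw => (hK hw).1,
      Or.inl (Or.inr (by simp [line])), Or.inr hKz, ?_⟩
    exact (isPreconnected_curves_union ha).union (Real.pi * I)
      (Or.inl (line_pi_subset_curves (by simp [line]))) hKpi hKc
  refine isPreconnected_of_forall 0 fun z hz => ?_
  rcases lt_trichotomy z.im 0 with h | h | h
  · obtain ⟨t, ht, h0, hzt, hc⟩ := hup (conj z) (conj_mem_eventuallyReal hz) (by simpa [upper])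
    refine ⟨conj '' t, ?_, ⟨0, h0, by simp⟩, ⟨_, hzt, by simp⟩,
      hc.image _ continuous_conj.continuousOn⟩
    rintro _ ⟨w, hw, rfl⟩
    exact conj_mem_eventuallyReal (ht hw)
  · exact ⟨line 0, subset_union_right.trans curves_union_subset, by simp [line], h,
      isPreconnected_line 0⟩
  · exact hup z hz h

/-! ### Eventually real points are dense in the escaping set -/

theorem eventuallyReal_subset_escapingSet (ha : -1 < a) :
    eventuallyReal a ⊆ escapingSet (expMap a) := by
  rintro z ⟨n, hn⟩
  obtain ⟨x, hx⟩ : ∃ x : ℝ, (expMap a)^[n] z = x := ⟨_, eq_ofReal_re_of_im_eq_zero hn⟩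
  have h : Tendsto (fun m => (expMap a)^[m + n] z) atTop (cocompact ℂ) := by
    simp only [Function.iterate_add_apply, hx, iterate_expMap_ofReal]
    rw [← Metric.cobounded_eq_cocompact, ← tendsto_norm_atTop_iff_cobounded]
    simp only [norm_real, Real.norm_eq_abs]
    exact tendsto_abs_atTop_atTop.comp (tendsto_iterate_realMap ha x)
  exact (tendsto_add_atTop_iff_nat (f := fun m => (expMap a)^[m] z) n).1 h

theorem hasDerivAt_expMap (z : ℂ) : HasDerivAt (expMap a) (exp z) z :=
  (hasDerivAt_exp z).add_const _

theorem differentiable_iterate_expMap (n : ℕ) : Differentiable ℂ (expMap a)^[n] :=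
  Differentiable.iterate (fun z => (hasDerivAt_expMap z).differentiableAt) n

theorem norm_deriv_iterate_succ (n : ℕ) (z : ℂ) :
    ‖deriv (expMap a)^[n + 1] z‖ =
      ‖(expMap a)^[n + 1] z - a‖ * ‖deriv (expMap a)^[n] z‖ := by
  rw [Function.iterate_succ', ((hasDerivAt_expMap _).comp z
    (differentiable_iterate_expMap n z).hasDerivAt).deriv, norm_mul]
  simp [expMap]

theorem deriv_iterate_ne_zero (n : ℕ) (z : ℂ) : deriv (expMap a)^[n] z ≠ 0 := by
  induction n with
  | zero => simp
  | succ n ih =>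
    rw [Function.iterate_succ', ((hasDerivAt_expMap _).comp z
      (differentiable_iterate_expMap n z).hasDerivAt).deriv]
    exact mul_ne_zero (exp_ne_zero _) ih

/-- By the chain rule each step multiplies the derivative by `exp` of the current iterate, which is
the next iterate minus `a`. Along an escaping orbit this factor eventually has norm at least `2`. -/
theorem tendsto_norm_deriv_iterate {z : ℂ} (hz : z ∈ escapingSet (expMap a)) :
    Tendsto (fun n => ‖deriv (expMap a)^[n] z‖) atTop atTop := by
  have h : ∀ᶠ n in atTop, 2 ≤ ‖(expMap a)^[n] z - a‖ := by
    have h1 : Tendsto (fun n => ‖(expMap a)^[n] z‖) atTop atTop :=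
      tendsto_norm_cocompact_atTop.comp hz
    filter_upwards [h1.eventually_ge_atTop (2 + ‖(a : ℂ)‖)] with n hn
    linarith [norm_sub_norm_le ((expMap a)^[n] z) a]
  obtain ⟨N, hN⟩ := eventually_atTop.1 h
  have hb : ∀ n, 2 ^ n * ‖deriv (expMap a)^[N] z‖ ≤ ‖deriv (expMap a)^[n + N] z‖ := by
    intro n
    induction n with
    | zero => simp
    | succ n ih =>
      rw [Nat.add_right_comm, norm_deriv_iterate_succ, pow_succ', mul_assoc]
      exact mul_le_mul (hN _ (by omega)) ih (by positivity) (norm_nonneg _)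
  refine (tendsto_add_atTop_iff_nat N).1 (tendsto_atTop_mono hb ?_)
  exact (tendsto_pow_atTop_atTop_of_one_lt one_lt_two).atTop_mul_const
    (norm_pos_iff.2 (deriv_iterate_ne_zero N z))

/-- A connected set missing all preimages of the real axis is mapped into strips of height `π`. -/
theorem im_sub_im_lt_pi {B : Set ℂ} (hB : IsPreconnected B) (hd : Disjoint B (eventuallyReal a))
    (n : ℕ) {z w : ℂ} (hz : z ∈ B) (hw : w ∈ B) :
    ((expMap a)^[n] z).im - ((expMap a)^[n] w).im < Real.pi := by
  by_contra! h
  set g : ℂ → ℝ := fun z => ((expMap a)^[n] z).im with hg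
  have hgc : Continuous g := continuous_im.comp (differentiable_iterate_expMap n).continuous
  have hord := (hB.image g hgc.continuousOn).ordConnected
  -- An oscillation of at least `π` covers some multiple of `π`; points at such heights map to the
  -- real axis in one step.
  set k : ℤ := ⌈g w / Real.pi⌉ with hk
  have hpos := Real.pi_pos
  have h1 : g w ≤ k * Real.pi := (div_le_iff₀ hpos).1 (Int.le_ceil _)
  have h2 : k * Real.pi ≤ g z := by
    have : (k : ℝ) < g w / Real.pi + 1 := Int.ceil_lt_add_one _
    have h3 : (k : ℝ) * Real.pi < (g w / Real.pi + 1) * Real.pi := by gcongr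
    rw [add_mul, div_mul_cancel₀ _ hpos.ne', one_mul] at h3
    change Real.pi ≤ g z - g w at h
    linarith
  obtain ⟨p, hp, hpk⟩ := hord.out (mem_image_of_mem g hw) (mem_image_of_mem g hz) ⟨h1, h2⟩
  obtain ⟨m, hm⟩ := (line_subset_eventuallyReal k hpk : (expMap a)^[n] p ∈ eventuallyReal a)
  exact disjoint_left.1 hd hp ⟨m + n, by rwa [Function.iterate_add_apply]⟩

/-- Write `g` for the iterate. The function `exp (I * (g w - g z))` has modulus `exp (im (g z) - im
(g w)) ≤ exp π` on the disc and derivative `I * g' z` at the centre, so Cauchy's estimate applies.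
-/
theorem norm_deriv_iterate_le {z : ℂ} {r : ℝ} (hr : 0 < r)
    (hd : Disjoint (Metric.closedBall z r) (eventuallyReal a)) (n : ℕ) :
    ‖deriv (expMap a)^[n] z‖ ≤ Real.exp Real.pi / r := by
  set g := (expMap a)^[n] with hg
  have hgd : Differentiable ℂ g := differentiable_iterate_expMap n
  set h : ℂ → ℂ := fun w => exp (I * (g w - g z)) with hh
  have hhd : Differentiable ℂ h := ((hgd.sub_const _).const_mul I).cexp
  have hderiv : deriv h z = I * deriv g z := by
    have := (((hgd z).hasDerivAt.sub_const (g z)).const_mul I).cexp.deriv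
    simpa using this
  have := norm_deriv_le_of_forall_mem_sphere_norm_le (f := h) (c := z) (C := Real.exp Real.pi) hr
    hhd.diffContOnCl fun w hw => by
      rw [hh, norm_exp]
      refine Real.exp_le_exp.2 ?_
      have := im_sub_im_lt_pi (convex_closedBall z r).isPreconnected hd n
        (Metric.mem_closedBall_self hr.le) (Metric.sphere_subset_closedBall hw)
      simpa using this.le
  rwa [hderiv, norm_mul, norm_I, one_mul] at this

theorem escapingSet_subset_closure : escapingSet (expMap a) ⊆ closure (eventuallyReal a) := by
  intro z hz
  by_contra hcl
  obtain ⟨r, hr, hsub⟩ := Metric.nhds_basis_closedBall.mem_iff.1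
    (isClosed_closure.isOpen_compl.mem_nhds hcl)
  have hd : Disjoint (Metric.closedBall z r) (eventuallyReal a) :=
    disjoint_left.2 fun w hw hwX => hsub hw (subset_closure hwX)
  obtain ⟨n, hn⟩ :=
    ((tendsto_norm_deriv_iterate hz).eventually_gt_atTop (Real.exp Real.pi / r)).exists
  exact hn.not_ge (norm_deriv_iterate_le hr hd n)

end ExpMap

theorem theorem1p1 (a : ℝ) (ha : -1 < a) : IsConnected (escapingSet (expMap a)) :=
  ⟨⟨0, ExpMap.eventuallyReal_subset_escapingSet ha ⟨0, rfl⟩⟩,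
    (ExpMap.isPreconnected_eventuallyReal ha).subset_closure
      (ExpMap.eventuallyReal_subset_escapingSet ha) ExpMap.escapingSet_subset_closure⟩
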